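/- Let $(y_i,x_i,Z_i,m_i)_{i\ge 1}$ be i.i.d., where $y_i,x_i\in\mathbb R$, $Z_i\in\mathbb R^L$, and $m_i\in\{0,1\}$ indicates that $x_i$ is missing ($m_i=1$). Let $$y_i=x_i\beta+u_i,\qquad x_i=Z_i'\pi+v_i ,$$ with $E[Z_iu_i]=0$, $E[Z_iv_i]=0$, $Q_{Zx}=E[Z_ix_i]\neq 0$, $Q_{xZ}=Q_{Zx}'$, and $Q_{ZZ}=E[Z_iZ_i']$ of full rank. A subscript $0$ (resp. $1$) means conditioning on $m_i=0$ (resp. $m_i=1$), e.g. $Q_{Z_0Z_0}=E[Z_iZ_i'\mid m_i=0]$ and $E[u_{1i}v_{1i}Z_{1i}Z_{1i}']=E[u_iv_iZ_iZ_i'\mid m_i=1]$; assume that $Q_{Z_0Z_0}$ has full rank. Let $n_1=\sum_{i\le n}m_i$ and suppose $n_1/n\to p$ in probability with $p<1$. (If $p=0$, the terms with subscript $1$ below are multiplied by $0$ and are absent.) Suppose that the missing structure is ignorable in the sense that $E[Z_iu_i\mid m_i]=E[Z_iu_i]$ and $E[Z_iv_i\mid m_i]=E[Z_iv_i]$; this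 holds, for example, if $m_i$ is independent of $(Z_i,u_i,v_i)$, or if $m_i$ is independent of $(u_i,v_i)$ given $Z_i$ and $E[u_i\mid Z_i]=E[v_i\mid Z_i]=0$. For a sample of size $n$ let $Z,x,y$ be the stacked data and $Z_0,x_0$ the rows with $m_i=0$. Let $\widehat\pi_{CC}=(Z_0'Z_0)^{-1}Z_0'x_0$; let $\widetilde x_i=x_i$ if $m_i=0$ and $\widetilde x_i=Z_i'\widehat\pi_{CC}$ if $m_i=1$; let $P_Z=Z(Z'Z)^{-1}Z'$ and $$\widehat\beta_{RI}=(\widetilde x'P_Z\widetilde x)^{-1}\widetilde x'P_Zy$$ (defined arbitrarily, say with the convention that inverses of singular matrices are $0$, on the event that some inverse does not exist). Suppose that $E[y_i^4]$, $E[\|Z_i\|^4]$ and $E[(x_i^{*})^4]$ are finite, where $x_i^{*}=x_i$ if $m_i=0$ and $x_i^{*}=Z_i'\pi$ if $m_i=1$, and that $E[v_i^2\|Z_i\|^2\mathbf 1\{m_i=1\}]$ is finite. Then, as $n\to\infty$, $$\sqrt n\,(\widehat\beta_{RI}-\beta)\xrightarrow{d}N(0,V),\qquad V=\left(Q_{xZ}Q_{ZZ}^{-1}Q_{Zx}\right)^{-1}Q_{xZ}Q_{ZZ}^{-1}\,\Omega\,Q_{ZZ}^{-1}Q_{Zx}\left(Q_{xZ}Q_{ZZ}^{-1}Q_{Zx}\right)^{-1}\ge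 0,$$ where $$\begin{aligned}\Omega={}&E[u_i^2Z_iZ_i']-2pE[u_{0i}v_{0i}Z_{0i}Z_{0i}']Q_{Z_0Z_0}^{-1}Q_{Z_1Z_1}\beta\\&+\frac{p^2}{1-p}Q_{Z_1Z_1}Q_{Z_0Z_0}^{-1}E[v_{0i}^2Z_{0i}Z_{0i}']Q_{Z_0Z_0}^{-1}Q_{Z_1Z_1}\beta^2\\&+2pE[u_{1i}v_{1i}Z_{1i}Z_{1i}']\beta+pE[v_{1i}^2Z_{1i}Z_{1i}']\beta^2 .\end{aligned}$$ -/

import Mathlib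

open MeasureTheory ProbabilityTheory Filter Matrix
open scoped Topology NNReal

noncomputable section

namespace RegImp

/-! ### Finite-sample estimators

`n` observations, `L` instruments; the `i`-th row of `Z` is the instrument vector of observation `i`
and `m i = true` says that `x i` is missing. -/

/-- The projection `P_Z = Z (Z'Z)⁻¹ Z'`. -/
def projMat {n L : ℕ} (Z : Matrix (Fin n) (Fin L) ℝ) : Matrix (Fin n) (Fin n) ℝ :=
  Z * (Zᵀ * Z)⁻¹ * Zᵀ

/-- The 2SLS estimator `(x' P_Z x)⁻¹ x' P_Z y`. -/
def tsls {n L : ℕ} (Z : Matrix (Fin n) (Fin L) ℝ) (x y : Fin n → ℝ) : ℝ :=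
  (x ⬝ᵥ projMat Z *ᵥ x)⁻¹ * (x ⬝ᵥ projMat Z *ᵥ y)

/-- Complete-case first stage `(Z₀'Z₀)⁻¹ Z₀'x₀`, where `Z₀`, `x₀` collect the rows at which `x` is
observed. -/
def piCC {n L : ℕ} (m : Fin n → Bool) (Z : Matrix (Fin n) (Fin L) ℝ) (x : Fin n → ℝ) :
    Fin L → ℝ :=
  let Z₀ : Matrix {i : Fin n // m i = false} (Fin L) ℝ := Z.submatrix Subtype.val id
  let x₀ : {i : Fin n // m i = false} → ℝ := fun i => x i.val
  (Z₀ᵀ * Z₀)⁻¹ *ᵥ (Z₀ᵀ *ᵥ x₀)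

/-- The imputed regressor: `x i` if observed, the complete-case first-stage prediction otherwise.
It does not depend on the values of `x` at missing positions. -/
def xImp {n L : ℕ} (m : Fin n → Bool) (Z : Matrix (Fin n) (Fin L) ℝ) (x : Fin n → ℝ) :
    Fin n → ℝ :=
  fun i => if m i = true then Z i ⬝ᵥ piCC m Z x else x i

/-- 2SLS after regression imputation. -/
def betaRI {n L : ℕ} (m : Fin n → Bool) (Z : Matrix (Fin n) (Fin L) ℝ) (x y : Fin n → ℝ) : ℝ :=
  tsls Z (xImp m Z x) y

/-! ### Population quantities -/

variable {Ω : Type*} [MeasurableSpace Ω] {L : ℕ}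

/-- The vector `E_ν[w Z]`. -/
def momVec (ν : Measure Ω) (w : Ω → ℝ) (Z : Ω → EuclideanSpace ℝ (Fin L)) : Fin L → ℝ :=
  fun j => ∫ ω, w ω * Z ω j ∂ν

/-- The matrix `E_ν[w Z Z']`. -/
def momMat (ν : Measure Ω) (w : Ω → ℝ) (Z : Ω → EuclideanSpace ℝ (Fin L)) :
    Matrix (Fin L) (Fin L) ℝ :=
  Matrix.of fun j k => ∫ ω, w ω * Z ω j * Z ω k ∂ν

/-- The conditional law given that `x` is observed (`b = false`) or missing (`b = true`). -/
def statusMeasure (μ : Measure Ω) (m : Ω → Bool) (b : Bool) : Measure Ω :=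
  ProbabilityTheory.cond μ (m ⁻¹' {b})

/-- The missing structure is ignorable: the mean of each of the moment functions `Z u` and `Z v` of
the model is the same among the complete observations, among the incomplete observations and in the
whole population, i.e. `E[Z u | m] = E[Z u]` and `E[Z v | m] = E[Z v]`. This holds if the status `m`
is independent of `(Z, u, v)` (missing completely at random); it also holds if `m` depends on the
observation through `Z` only and the errors have zero mean given `Z` (missing at random). -/
def Ignorable (μ : Measure Ω) (m : Ω → Bool) (Z : Ω → EuclideanSpace ℝ (Fin L)) (u v : Ω → ℝ) :
    Prop :=
  ∀ b : Bool, μ (m ⁻¹' {b}) ≠ 0 →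
    momVec (statusMeasure μ m b) u Z = momVec μ u Z ∧
    momVec (statusMeasure μ m b) v Z = momVec μ v Z

/-- The matrix `Ω`: subscript `0` (`1`) means conditional on `x` being observed (missing). -/
def omegaRI (μ : Measure Ω) (m : Ω → Bool) (Z : Ω → EuclideanSpace ℝ (Fin L)) (u v : Ω → ℝ)
    (p β : ℝ) : Matrix (Fin L) (Fin L) ℝ :=
  let μ₀ := statusMeasure μ m false
  let μ₁ := statusMeasure μ m true
  let Q₀ := momMat μ₀ (fun _ => 1) Z
  let Q₁ := momMat μ₁ (fun _ => 1) Z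
  momMat μ (fun ω => u ω ^ 2) Z
    - (2 * p * β) • (momMat μ₀ (fun ω => u ω * v ω) Z * Q₀⁻¹ * Q₁)
    + (p ^ 2 / (1 - p) * β ^ 2) • (Q₁ * Q₀⁻¹ * momMat μ₀ (fun ω => v ω ^ 2) Z * Q₀⁻¹ * Q₁)
    + (2 * p * β) • momMat μ₁ (fun ω => u ω * v ω) Z
    + (p * β ^ 2) • momMat μ₁ (fun ω => v ω ^ 2) Z

/-- The sandwich `(q'Q⁻¹q)⁻¹ q'Q⁻¹ W Q⁻¹q (q'Q⁻¹q)⁻¹`. -/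
def sandwich (q : Fin L → ℝ) (Q W : Matrix (Fin L) (Fin L) ℝ) : ℝ :=
  (q ⬝ᵥ Q⁻¹ *ᵥ q)⁻¹ * (q ⬝ᵥ (Q⁻¹ * W * Q⁻¹) *ᵥ q) * (q ⬝ᵥ Q⁻¹ *ᵥ q)⁻¹

/-- The asymptotic variance of 2SLS after regression imputation. -/
def asymVar (μ : Measure Ω) (m : Ω → Bool) (Z : Ω → EuclideanSpace ℝ (Fin L)) (x u v : Ω → ℝ)
    (p β : ℝ) : ℝ :=
  sandwich (momVec μ x Z) (momMat μ (fun _ => 1) Z) (omegaRI μ m Z u v p β)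

end RegImp

end

/-! The estimation error is, whenever the sample inverses exist, exactly linear in two mean-zero
sample moments; no expansion is needed. Write `G`, `G₀`, `G₁` for the sample Gram matrices of all,
observed and missing rows and `c` for the observed cross moment of `Z` and `x`. Imputed rows
contribute `G₁ π̂` with `π̂ = G₀⁻¹ c`, so the imputed cross moment is `h = c + G₁ G₀⁻¹ c`, and the
estimator is `r · z`, where `r` is the 2SLS row of `h` and `G`, so that `r · h = 1`, and `z` is the
cross moment of `Z` and `y`.

Let `b` be the sample mean of `1{m=0} v Z` and `a` that of `(u + β 1{m=1} v) Z`. Then `c = G₀ π + b`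
and `z = β (c + G₁ π) + a`, while `h = c + G₁ π + G₁ G₀⁻¹ b`; hence the error is `r · a - β r G₁
G₀⁻¹ b` (`tslsRow_impCross_sub`).

Instrument validity and ignorability make both moments centred. By the strong law the coefficients
converge almost surely, so Slutsky and a scalar central limit theorem for the limiting linear
combination give normality (`tendstoInDistribution_of_ae_eventually_eq_sum`). The variance is the
second moment of the influence function. Products of the two status indicators vanish, and the
weights `p` and `1 - p` relating restricted to conditional moments turn it into the sandwich with
`Ω` (`dotProduct_omegaRI_mulVec`). -/

namespace RegImp

/-! ### Finite-sample algebra -/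

section Algebra

variable {L : ℕ}

/-- The row `(h'G⁻¹h)⁻¹ h'G⁻¹`: the 2SLS estimator is its product with the instrument–outcome
cross moment, where `h` is the instrument–regressor cross moment and `G` the Gram matrix. -/
noncomputable def tslsRow (h : Fin L → ℝ) (G : Matrix (Fin L) (Fin L) ℝ) : Fin L → ℝ :=
  (h ⬝ᵥ G⁻¹ *ᵥ h)⁻¹ • (h ᵥ* G⁻¹)

/-- The instrument–regressor cross moment after imputation, in terms of the cross moment `c` among
the complete observations and the Gram matrices of the complete and the incomplete ones. -/
noncomputable def impCross (c : Fin L → ℝ) (G₀ G₁ : Matrix (Fin L) (Fin L) ℝ) : Fin L → ℝ :=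
  c + G₁ *ᵥ (G₀⁻¹ *ᵥ c)

/-- A singular matrix has inverse `0` on both sides, so invertibility is not needed. This and the
two homogeneity lemmas after it let sums be replaced by averages in every sample. -/
lemma inv_smul_of_ne_zero {t : ℝ} (ht : t ≠ 0) (G : Matrix (Fin L) (Fin L) ℝ) :
    (t • G)⁻¹ = t⁻¹ • G⁻¹ := by
  by_cases h : IsUnit G.det
  · exact Matrix.inv_smul' G (Units.mk0 t ht) h
  · have h' : ¬ IsUnit (t • G).det := by
      simp only [det_smul, isUnit_iff_ne_zero, ne_eq, mul_eq_zero, not_not] at h ⊢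
      exact Or.inr h
    rw [nonsing_inv_apply_not_isUnit _ h, nonsing_inv_apply_not_isUnit _ h', smul_zero]

lemma tslsRow_smul {t : ℝ} (ht : t ≠ 0) (h : Fin L → ℝ) (G : Matrix (Fin L) (Fin L) ℝ) :
    tslsRow (t • h) (t • G) = t⁻¹ • tslsRow h G := by
  simp only [tslsRow, inv_smul_of_ne_zero ht, smul_dotProduct, mulVec_smul, smul_mulVec,
    dotProduct_smul, smul_vecMul, vecMul_smul, smul_smul, smul_eq_mul]
  congr 1
  field_simp

lemma impCross_smul {t : ℝ} (ht : t ≠ 0) (c : Fin L → ℝ) (G₀ G₁ : Matrix (Fin L) (Fin L) ℝ) :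
    impCross (t • c) (t • G₀) (t • G₁) = t • impCross c G₀ G₁ := by
  simp only [impCross, inv_smul_of_ne_zero ht, mulVec_smul, smul_mulVec, smul_smul, smul_add]
  congr 2
  field_simp

lemma tslsRow_dotProduct_self {h : Fin L → ℝ} {G : Matrix (Fin L) (Fin L) ℝ}
    (hG : h ⬝ᵥ G⁻¹ *ᵥ h ≠ 0) : tslsRow h G ⬝ᵥ h = 1 := by
  rw [tslsRow, smul_dotProduct, ← dotProduct_mulVec, smul_eq_mul, inv_mul_cancel₀ hG]

lemma dotProduct_projMat_mulVec {n : ℕ} (Z : Matrix (Fin n) (Fin L) ℝ) (x y : Fin n → ℝ) :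
    x ⬝ᵥ projMat Z *ᵥ y = (Zᵀ *ᵥ x) ⬝ᵥ (Zᵀ * Z)⁻¹ *ᵥ (Zᵀ *ᵥ y) := by
  rw [projMat, ← mulVec_mulVec, ← mulVec_mulVec, dotProduct_mulVec, ← mulVec_transpose]

lemma tsls_eq {n : ℕ} (Z : Matrix (Fin n) (Fin L) ℝ) (x y : Fin n → ℝ) :
    tsls Z x y = tslsRow (Zᵀ *ᵥ x) (Zᵀ * Z) ⬝ᵥ (Zᵀ *ᵥ y) := by
  rw [tsls, dotProduct_projMat_mulVec, dotProduct_projMat_mulVec, tslsRow, smul_dotProduct,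
    ← dotProduct_mulVec, smul_eq_mul]

/-- The estimation error of 2SLS after imputation as a linear form in the two error moments. -/
lemma tslsRow_impCross_sub {G G₀ G₁ : Matrix (Fin L) (Fin L) ℝ} {π a b c z : Fin L → ℝ} {β : ℝ}
    (hG₀ : IsUnit G₀.det) (hc : c = G₀ *ᵥ π + b) (hz : z = β • (c + G₁ *ᵥ π) + a)
    (hD : impCross c G₀ G₁ ⬝ᵥ G⁻¹ *ᵥ impCross c G₀ G₁ ≠ 0) :
    tslsRow (impCross c G₀ G₁) G ⬝ᵥ z - β =
      tslsRow (impCross c G₀ G₁) G ⬝ᵥ a +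
        (-β • (tslsRow (impCross c G₀ G₁) G ᵥ* (G₁ * G₀⁻¹))) ⬝ᵥ b := by
  have h1 := tslsRow_dotProduct_self hD
  -- The last term is the price of imputing with the estimated instead of the true first-stage
  -- coefficient.
  have h2 : z = β • impCross c G₀ G₁ + a - β • ((G₁ * G₀⁻¹) *ᵥ b) := by
    rw [hz, impCross]
    have : G₀⁻¹ *ᵥ c = π + G₀⁻¹ *ᵥ b := by
      rw [hc, mulVec_add, mulVec_mulVec, nonsing_inv_mul _ hG₀, one_mulVec]
    rw [this, mulVec_add, ← mulVec_mulVec]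
    module
  generalize tslsRow (impCross c G₀ G₁) G = r at *
  rw [h2, dotProduct_sub, dotProduct_add, dotProduct_smul, dotProduct_smul, h1, smul_dotProduct,
    ← dotProduct_mulVec]
  simp only [smul_eq_mul]
  ring

/-- The weighted Gram matrix `∑ wᵢ Zᵢ Zᵢ'`. -/
noncomputable def gram {n : ℕ} (w : Fin n → ℝ) (Z : Matrix (Fin n) (Fin L) ℝ) : Matrix (Fin L) (Fin L) ℝ :=
  Matrix.of fun j k => ∑ i, w i * Z i j * Z i k

/-- The weighted sum `∑ wᵢ Zᵢ`. -/
noncomputable def cross {n : ℕ} (w : Fin n → ℝ) (Z : Matrix (Fin n) (Fin L) ℝ) : Fin L → ℝ :=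
  fun j => ∑ i, w i * Z i j

/-- The indicator of status `b`. -/
noncomputable def ind (b c : Bool) : ℝ := if c = b then 1 else 0

lemma transpose_mulVec_eq_cross {n : ℕ} (w : Fin n → ℝ) (Z : Matrix (Fin n) (Fin L) ℝ) :
    Zᵀ *ᵥ w = cross w Z := by
  ext j
  simp [mulVec, dotProduct, cross, mul_comm]

/-- Indicator weights turn sums over a random set of rows into sums over all rows, to which the
limit theorems for i.i.d. terms apply. -/
lemma piCC_eq {n : ℕ} (m : Fin n → Bool) (Z : Matrix (Fin n) (Fin L) ℝ) (x : Fin n → ℝ) :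
    piCC m Z x =
      (gram (fun i => ind false (m i)) Z)⁻¹ *ᵥ cross (fun i => ind false (m i) * x i) Z := by
  have sub (f : Fin n → ℝ) :
      ∑ i : {i : Fin n // m i = false}, f i = ∑ i, ind false (m i) * f i := by
    rw [← Finset.sum_subtype (Finset.univ.filter fun i => m i = false) (by simp) f,
      Finset.sum_filter]
    simp [ind]
  rw [piCC]
  congr 2
  · ext j k
    simp only [mul_apply, transpose_apply, submatrix_apply, id, gram, of_apply]
    rw [sub fun i => Z i j * Z i k]
    simp only [mul_assoc]
  · ext j
    simp only [mulVec, dotProduct, transpose_apply, submatrix_apply, id, cross]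
    rw [sub fun i => Z i j * x i]
    exact Finset.sum_congr rfl fun i _ => by ring

lemma cross_xImp {n : ℕ} (m : Fin n → Bool) (Z : Matrix (Fin n) (Fin L) ℝ) (x : Fin n → ℝ) :
    cross (xImp m Z x) Z =
      impCross (cross (fun i => ind false (m i) * x i) Z) (gram (fun i => ind false (m i)) Z)
        (gram (fun i => ind true (m i)) Z) := by
  ext j
  rw [impCross, ← piCC_eq]
  simp only [cross, Pi.add_apply, mulVec, dotProduct, gram, of_apply, Finset.sum_mul]
  rw [Finset.sum_comm, ← Finset.sum_add_distrib]
  refine Finset.sum_congr rfl fun i _ => ?_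
  rw [xImp]
  cases m i <;> simp [ind, dotProduct, Finset.sum_mul]
  exact Finset.sum_congr rfl fun k _ => by ring

lemma betaRI_eq {n : ℕ} (m : Fin n → Bool) (Z : Matrix (Fin n) (Fin L) ℝ) (x y : Fin n → ℝ) :
    betaRI m Z x y =
      tslsRow (impCross (cross (fun i => ind false (m i) * x i) Z)
        (gram (fun i => ind false (m i)) Z) (gram (fun i => ind true (m i)) Z))
        (gram (fun _ => 1) Z) ⬝ᵥ cross y Z := by
  rw [betaRI, tsls_eq, transpose_mulVec_eq_cross, transpose_mulVec_eq_cross, cross_xImp]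
  congr 2
  ext j k
  simp [gram, mul_apply]

end Algebra

/-! ### Limit theorems for sample moments -/

section Limits

variable {Ω T : Type*} [MeasurableSpace Ω] [MeasurableSpace T]

/-- Convergence in distribution to zero implies convergence in measure. -/
lemma tendstoInMeasure_zero_of_tendstoInDistribution {Ω' : Type*} [MeasurableSpace Ω']
    {μ : Measure Ω} [IsProbabilityMeasure μ] {ν : Measure Ω'} [IsProbabilityMeasure ν]
    {X : ℕ → Ω → ℝ} (h : TendstoInDistribution X atTop (fun _ : Ω' => (0 : ℝ)) (fun _ => μ) ν) :
    TendstoInMeasure μ X atTop 0 := by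
  rw [tendstoInMeasure_iff_dist]
  intro ε hε
  have hclosed : IsClosed {t : ℝ | ε ≤ dist t 0} :=
    isClosed_le continuous_const (continuous_id.dist continuous_const)
  have hfr : (0 : ℝ) ∉ frontier {t : ℝ | ε ≤ dist t 0} := fun h0 => by
    have h1 := hclosed.frontier_subset h0
    rw [Set.mem_ofPred_eq, dist_self] at h1
    linarith
  have hnull : ν.map (fun _ : Ω' => (0 : ℝ)) (frontier {t : ℝ | ε ≤ dist t 0}) = 0 := by
    rw [Measure.map_const, measure_univ, one_smul, Measure.dirac_apply' _
      isClosed_frontier.measurableSet, Set.indicator_of_notMem hfr]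
  -- Portmanteau: the limit law, a point mass at `0`, charges neither this set nor its frontier
  -- because `ε > 0`.
  have key := ProbabilityMeasure.tendsto_measure_of_null_frontier_of_tendsto' h.tendsto
    (E := {t : ℝ | ε ≤ dist t 0}) hnull
  have h0 : ν.map (fun _ : Ω' => (0 : ℝ)) {t : ℝ | ε ≤ dist t 0} = 0 := by
    rw [Measure.map_const, measure_univ, one_smul, Measure.dirac_apply' _ hclosed.measurableSet,
      Set.indicator_of_notMem (by simpa using hε)]
  simp only [ProbabilityMeasure.coe_mk] at key
  rw [h0] at key
  refine key.congr fun n => ?_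
  rw [Measure.map_apply_of_aemeasurable (h.forall_aemeasurable n) hclosed.measurableSet]
  rfl

/-- The sample mean of `g (ξ i)`, `i < n`. -/
noncomputable def empMean (ξ : ℕ → Ω → T) (g : T → ℝ) (n : ℕ) (ω : Ω) : ℝ :=
  (n : ℝ)⁻¹ * ∑ i ∈ Finset.range n, g (ξ i ω)

lemma measurable_empMean {ξ : ℕ → Ω → T} (hξ : ∀ i, Measurable (ξ i)) {g : T → ℝ}
    (hg : Measurable g) (n : ℕ) : Measurable (empMean ξ g n) := by
  unfold empMean
  fun_prop

omit [MeasurableSpace Ω] [MeasurableSpace T] in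
lemma sqrt_mul_empMean (ξ : ℕ → Ω → T) (g : T → ℝ) (n : ℕ) (ω : Ω) :
    √(n : ℝ) * empMean ξ g n ω = (√(n : ℝ))⁻¹ * ∑ i ∈ Finset.range n, g (ξ i ω) := by
  rcases Nat.eq_zero_or_pos n with rfl | hn
  · simp
  · have hn' : (0 : ℝ) < n := by exact_mod_cast hn
    rw [empMean, ← mul_assoc]
    congr 1
    have := Real.mul_self_sqrt hn'.le
    have h0 : √(n : ℝ) ≠ 0 := (Real.sqrt_pos.2 hn').ne'
    field_simp
    nlinarith

variable {μ : Measure Ω} {ξ : ℕ → Ω → T}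

lemma ae_tendsto_empMean (hindep : iIndepFun ξ μ)
    (hident : ∀ i, IdentDistrib (ξ i) (ξ 0) μ μ) {g : T → ℝ} (hg : Measurable g)
    (hint : Integrable (fun ω => g (ξ 0 ω)) μ) :
    ∀ᵐ ω ∂μ, Tendsto (fun n => empMean ξ g n ω) atTop (𝓝 (∫ ω, g (ξ 0 ω) ∂μ)) :=
  strong_law_ae (fun i ω => g (ξ i ω)) hint
    (fun _ _ hij => (hindep.indepFun hij).comp hg hg) fun i => (hident i).comp hg

variable [IsProbabilityMeasure μ]

lemma tendstoInDistribution_sqrt_mul_empMean (hindep : iIndepFun ξ μ)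
    (hident : ∀ i, IdentDistrib (ξ i) (ξ 0) μ μ) {g : T → ℝ} (hg : Measurable g)
    (h2 : MemLp (fun ω => g (ξ 0 ω)) 2 μ) (h0 : ∫ ω, g (ξ 0 ω) ∂μ = 0) :
    TendstoInDistribution (fun (n : ℕ) ω => √(n : ℝ) * empMean ξ g n ω) atTop (id : ℝ → ℝ)
      (fun _ => μ) (gaussianReal 0 (∫ ω, g (ξ 0 ω) ^ 2 ∂μ).toNNReal) := by
  have hvar : Var[fun ω => g (ξ 0 ω); μ] = ∫ ω, g (ξ 0 ω) ^ 2 ∂μ := by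
    rw [variance_of_integral_eq_zero h2.aestronglyMeasurable.aemeasurable h0]
  have := tendstoInDistribution_inv_sqrt_mul_sum_sub (P := μ) (X := fun i ω => g (ξ i ω))
    (P' := gaussianReal 0 (∫ ω, g (ξ 0 ω) ^ 2 ∂μ).toNNReal) (Y := id)
    (by rw [hvar]; exact HasLaw.id) h2 (hindep.comp _ fun _ => hg) fun i => (hident i).comp hg
  simpa only [h0, mul_zero, sub_zero, sqrt_mul_empMean] using this

/-- **Central limit theorem with estimated coefficients**: a statistic that eventually equals a
linear combination of normalized sample means, with coefficients converging almost surely, is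
asymptotically normal. -/
theorem tendstoInDistribution_of_ae_eventually_eq_sum {ι : Type*} [Fintype ι]
    (hξ : ∀ i, Measurable (ξ i)) (hindep : iIndepFun ξ μ)
    (hident : ∀ i, IdentDistrib (ξ i) (ξ 0) μ μ) {g : ι → T → ℝ} (hg : ∀ k, Measurable (g k))
    (h2 : ∀ k, MemLp (fun ω => g k (ξ 0 ω)) 2 μ) (h0 : ∀ k, ∫ ω, g k (ξ 0 ω) ∂μ = 0)
    {C : ℕ → Ω → ι → ℝ} (hC : ∀ n k, Measurable fun ω => C n ω k) {c : ι → ℝ}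
    (hCc : ∀ᵐ ω ∂μ, ∀ k, Tendsto (fun n => C n ω k) atTop (𝓝 (c k)))
    {Y : ℕ → Ω → ℝ} (hY : ∀ n, Measurable (Y n))
    (hYC : ∀ᵐ ω ∂μ, ∀ᶠ n in atTop,
      Y n ω = ∑ k, C n ω k * (√(n : ℝ) * empMean ξ (g k) n ω)) :
    TendstoInDistribution Y atTop (id : ℝ → ℝ) (fun _ => μ)
      (gaussianReal 0 (∫ ω, (∑ k, c k * g k (ξ 0 ω)) ^ 2 ∂μ).toNNReal) := by
  classical
  have hS k (n : ℕ) : Measurable fun ω => √(n : ℝ) * empMean ξ (g k) n ω :=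
    (measurable_empMean hξ (hg k) n).const_mul _
  -- With the coefficients frozen at their limits, the combination is itself the sample mean of one
  -- real function, so the scalar theorem suffices.
  have hlim := tendstoInDistribution_sqrt_mul_empMean hindep hident
    (g := fun t => ∑ k, c k * g k t) (by fun_prop)
    (memLp_finsetSum _ fun k _ => (h2 k).const_mul (c k)) (by
      rw [integral_finsetSum _ fun k _ => ((h2 k).integrable one_le_two).const_mul (c k)]
      simp [integral_const_mul, h0])
  -- Slutsky: a factor tending to `0` in probability times one converging in law tends to `0` in
  -- law, hence in probability.
  have hrem k : TendstoInMeasure μ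
      (fun (n : ℕ) ω => (C n ω k - c k) * (√(n : ℝ) * empMean ξ (g k) n ω)) atTop 0 := by
    have hd : TendstoInMeasure μ (fun (n : ℕ) ω => C n ω k - c k) atTop fun _ => 0 := by
      refine tendstoInMeasure_of_tendsto_ae
        (fun n => ((hC n k).sub_const _).aestronglyMeasurable) ?_
      filter_upwards [hCc] with ω hω
      simpa using (hω k).sub_const (c k)
    have := (tendstoInDistribution_sqrt_mul_empMean hindep hident (hg k) (h2 k)
      (h0 k)).continuous_comp_prodMk_of_tendstoInMeasure_const
      (g := fun q : ℝ × ℝ => q.2 * q.1) (by fun_prop) hd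
      fun n => ((hC n k).sub_const _).aemeasurable
    refine tendstoInMeasure_zero_of_tendstoInDistribution ?_
      (ν := gaussianReal 0 (∫ ω, g k (ξ 0 ω) ^ 2 ∂μ).toNNReal)
    simpa only [zero_mul] using this
  -- The negligible remainders are added one index at a time.
  have hsum (s : Finset ι) : TendstoInDistribution
      (fun (n : ℕ) ω => √(n : ℝ) * empMean ξ (fun t => ∑ k, c k * g k t) n ω +
        ∑ k ∈ s, (C n ω k - c k) * (√(n : ℝ) * empMean ξ (g k) n ω)) atTop (id : ℝ → ℝ)
      (fun _ => μ) (gaussianReal 0 (∫ ω, (∑ k, c k * g k (ξ 0 ω)) ^ 2 ∂μ).toNNReal) := by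
    induction s using Finset.induction_on with
    | empty => simpa using hlim
    | insert k s hk ih =>
      refine tendstoInDistribution_of_tendstoInMeasure_sub _ _ ih ?_ fun n => ?_
      · convert! hrem k using 1
        ext n ω
        simp only [Pi.sub_apply, Finset.sum_insert hk]
        ring
      · exact ((measurable_empMean hξ (by fun_prop) n).const_mul _ |>.add
          (Finset.measurable_fun_sum _ fun k _ =>
            ((hC n k).sub_const _).mul (hS k n))).aemeasurable
  refine tendstoInDistribution_of_tendstoInMeasure_sub _ _ (hsum Finset.univ) ?_
    fun n => (hY n).aemeasurable
  refine tendstoInMeasure_of_tendsto_ae (fun n => ?_) ?_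
  · exact ((hY n).aemeasurable.sub ((hsum Finset.univ).forall_aemeasurable n)).aestronglyMeasurable
  · filter_upwards [hYC] with ω hω
    refine tendsto_const_nhds.congr' ?_
    filter_upwards [hω] with n hn
    have hlin : empMean ξ (fun t => ∑ k, c k * g k t) n ω = ∑ k, c k * empMean ξ (g k) n ω := by
      simp only [empMean, Finset.mul_sum]
      rw [Finset.sum_comm]
      exact Finset.sum_congr rfl fun _ _ => Finset.sum_congr rfl fun _ _ => by ring
    simp only [Pi.sub_apply, Pi.zero_apply, hn, hlin, Finset.mul_sum, ← Finset.sum_add_distrib,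
      ← Finset.sum_sub_distrib]
    exact (Finset.sum_eq_zero fun _ _ => by ring).symm

end Limits

/-! ### Measurability and continuity of the moment functions -/

section Regularity

variable {Ω : Type*} [MeasurableSpace Ω] {L : ℕ}

lemma measurable_det {A : Ω → Matrix (Fin L) (Fin L) ℝ}
    (hA : ∀ j k, Measurable fun ω => A ω j k) : Measurable fun ω => (A ω).det := by
  simp only [det_apply]
  exact Finset.measurable_fun_sum _ fun σ _ =>
    (Finset.measurable_fun_prod _ fun i _ => hA _ _).const_smul _

/-- The formula adjugate over determinant, with `0⁻¹ = 0`, also covers singular matrices, so no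
restriction to the invertible ones is needed. -/
lemma measurable_matrix_inv {A : Ω → Matrix (Fin L) (Fin L) ℝ}
    (hA : ∀ j k, Measurable fun ω => A ω j k) (j k : Fin L) :
    Measurable fun ω => (A ω)⁻¹ j k := by
  simp only [inv_def, Ring.inverse_eq_inv', Matrix.smul_apply, adjugate_apply, smul_eq_mul]
  refine (measurable_det hA).inv.mul (measurable_det fun i l => ?_)
  simp only [updateRow_apply]
  split_ifs
  · exact measurable_const
  · exact hA i l

lemma measurable_mulVec {A : Ω → Matrix (Fin L) (Fin L) ℝ} {a : Ω → Fin L → ℝ}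
    (hA : ∀ j k, Measurable fun ω => A ω j k) (ha : ∀ j, Measurable fun ω => a ω j) (j : Fin L) :
    Measurable fun ω => (A ω *ᵥ a ω) j := by
  simp only [mulVec, dotProduct]
  exact Finset.measurable_fun_sum _ fun k _ => (hA j k).mul (ha k)

lemma measurable_vecMul {A : Ω → Matrix (Fin L) (Fin L) ℝ} {a : Ω → Fin L → ℝ}
    (hA : ∀ j k, Measurable fun ω => A ω j k) (ha : ∀ j, Measurable fun ω => a ω j) (j : Fin L) :
    Measurable fun ω => (a ω ᵥ* A ω) j := by
  simp only [vecMul, dotProduct]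
  exact Finset.measurable_fun_sum _ fun k _ => (ha k).mul (hA k j)

lemma measurable_dotProduct {a b : Ω → Fin L → ℝ} (ha : ∀ j, Measurable fun ω => a ω j)
    (hb : ∀ j, Measurable fun ω => b ω j) : Measurable fun ω => a ω ⬝ᵥ b ω := by
  simp only [dotProduct]
  exact Finset.measurable_fun_sum _ fun k _ => (ha k).mul (hb k)

lemma measurable_tslsRow {h : Ω → Fin L → ℝ} {G : Ω → Matrix (Fin L) (Fin L) ℝ}
    (hh : ∀ j, Measurable fun ω => h ω j) (hG : ∀ j k, Measurable fun ω => G ω j k) (j : Fin L) :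
    Measurable fun ω => tslsRow (h ω) (G ω) j := by
  simp only [tslsRow, Pi.smul_apply, smul_eq_mul]
  exact (measurable_dotProduct hh (measurable_mulVec (measurable_matrix_inv hG) hh)).inv.mul
    (measurable_vecMul (measurable_matrix_inv hG) hh j)

lemma measurable_impCross {c : Ω → Fin L → ℝ} {G₀ G₁ : Ω → Matrix (Fin L) (Fin L) ℝ}
    (hc : ∀ j, Measurable fun ω => c ω j) (hG₀ : ∀ j k, Measurable fun ω => G₀ ω j k)
    (hG₁ : ∀ j k, Measurable fun ω => G₁ ω j k) (j : Fin L) :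
    Measurable fun ω => impCross (c ω) (G₀ ω) (G₁ ω) j := by
  simp only [impCross, Pi.add_apply]
  exact (hc j).add (measurable_mulVec hG₁ (measurable_mulVec (measurable_matrix_inv hG₀) hc) j)

lemma measurable_matrix_mul {A B : Ω → Matrix (Fin L) (Fin L) ℝ}
    (hA : ∀ j k, Measurable fun ω => A ω j k) (hB : ∀ j k, Measurable fun ω => B ω j k)
    (j k : Fin L) : Measurable fun ω => (A ω * B ω) j k := by
  simp only [mul_apply]
  exact Finset.measurable_fun_sum _ fun l _ => (hA j l).mul (hB l k)

variable {ι : Type*} {l : Filter ι}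

lemma tendsto_matrix_inv {A : ι → Matrix (Fin L) (Fin L) ℝ} {A' : Matrix (Fin L) (Fin L) ℝ}
    (hA : Tendsto A l (𝓝 A')) (hdet : IsUnit A'.det) :
    Tendsto (fun i => (A i)⁻¹) l (𝓝 A'⁻¹) := by
  refine (continuousAt_matrix_inv A' ?_).tendsto.comp hA
  simpa only [Ring.inverse_eq_inv'] using! continuousAt_inv₀ hdet.ne_zero

lemma tendsto_mulVec {A : ι → Matrix (Fin L) (Fin L) ℝ} {A' : Matrix (Fin L) (Fin L) ℝ}
    {a : ι → Fin L → ℝ} {a' : Fin L → ℝ} (hA : Tendsto A l (𝓝 A')) (ha : Tendsto a l (𝓝 a')) :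
    Tendsto (fun i => A i *ᵥ a i) l (𝓝 (A' *ᵥ a')) :=
  ((continuous_fst.matrix_mulVec continuous_snd).tendsto (A', a')).comp (hA.prodMk_nhds ha)

lemma tendsto_vecMul {A : ι → Matrix (Fin L) (Fin L) ℝ} {A' : Matrix (Fin L) (Fin L) ℝ}
    {a : ι → Fin L → ℝ} {a' : Fin L → ℝ} (hA : Tendsto A l (𝓝 A')) (ha : Tendsto a l (𝓝 a')) :
    Tendsto (fun i => a i ᵥ* A i) l (𝓝 (a' ᵥ* A')) :=
  ((continuous_snd.matrix_vecMul continuous_fst).tendsto (A', a')).comp (hA.prodMk_nhds ha)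

lemma tendsto_dotProduct {a b : ι → Fin L → ℝ} {a' b' : Fin L → ℝ} (ha : Tendsto a l (𝓝 a'))
    (hb : Tendsto b l (𝓝 b')) : Tendsto (fun i => a i ⬝ᵥ b i) l (𝓝 (a' ⬝ᵥ b')) :=
  ((continuous_fst.dotProduct continuous_snd).tendsto (a', b')).comp (ha.prodMk_nhds hb)

lemma tendsto_firstStage_form {h : ι → Fin L → ℝ} {h' : Fin L → ℝ}
    {G : ι → Matrix (Fin L) (Fin L) ℝ} {G' : Matrix (Fin L) (Fin L) ℝ} (hh : Tendsto h l (𝓝 h'))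
    (hG : Tendsto G l (𝓝 G')) (hdet : IsUnit G'.det) :
    Tendsto (fun i => h i ⬝ᵥ (G i)⁻¹ *ᵥ h i) l (𝓝 (h' ⬝ᵥ G'⁻¹ *ᵥ h')) :=
  tendsto_dotProduct hh (tendsto_mulVec (tendsto_matrix_inv hG hdet) hh)

lemma tendsto_tslsRow {h : ι → Fin L → ℝ} {h' : Fin L → ℝ}
    {G : ι → Matrix (Fin L) (Fin L) ℝ} {G' : Matrix (Fin L) (Fin L) ℝ} (hh : Tendsto h l (𝓝 h'))
    (hG : Tendsto G l (𝓝 G')) (hdet : IsUnit G'.det) (hD : h' ⬝ᵥ G'⁻¹ *ᵥ h' ≠ 0) :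
    Tendsto (fun i => tslsRow (h i) (G i)) l (𝓝 (tslsRow h' G')) :=
  ((tendsto_firstStage_form hh hG hdet).inv₀ hD).smul
    (tendsto_vecMul (tendsto_matrix_inv hG hdet) hh)

lemma tendsto_impCross {c : ι → Fin L → ℝ} {c' : Fin L → ℝ}
    {G₀ G₁ : ι → Matrix (Fin L) (Fin L) ℝ} {G₀' G₁' : Matrix (Fin L) (Fin L) ℝ}
    (hc : Tendsto c l (𝓝 c')) (hG₀ : Tendsto G₀ l (𝓝 G₀')) (hG₁ : Tendsto G₁ l (𝓝 G₁'))
    (hdet : IsUnit G₀'.det) :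
    Tendsto (fun i => impCross (c i) (G₀ i) (G₁ i)) l (𝓝 (impCross c' G₀' G₁')) :=
  hc.add (tendsto_mulVec hG₁ (tendsto_mulVec (tendsto_matrix_inv hG₀ hdet) hc))

end Regularity

/-! ### Population moments -/

section Population

variable {Ω : Type*} [MeasurableSpace Ω] {μ : Measure Ω} {L : ℕ}
  {Z : Ω → EuclideanSpace ℝ (Fin L)}

lemma momMat_transpose (w : Ω → ℝ) : (momMat μ w Z)ᵀ = momMat μ w Z := by
  ext j k
  simp only [momMat, transpose_apply, of_apply, mul_right_comm]

lemma mul_dotProduct_mul_dotProduct (w : ℝ) (a b z : Fin L → ℝ) :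
    w * (a ⬝ᵥ z) * (b ⬝ᵥ z) = ∑ j, ∑ k, a j * b k * (w * z j * z k) := by
  simp only [dotProduct]
  rw [mul_assoc, Finset.sum_mul_sum, Finset.mul_sum]
  refine Finset.sum_congr rfl fun j _ => ?_
  rw [Finset.mul_sum]
  exact Finset.sum_congr rfl fun k _ => by ring

lemma dotProduct_momMat_mulVec {w : Ω → ℝ}
    (hw : ∀ j k, Integrable (fun ω => w ω * Z ω j * Z ω k) μ) (a b : Fin L → ℝ) :
    a ⬝ᵥ momMat μ w Z *ᵥ b = ∫ ω, w ω * (a ⬝ᵥ (Z ω).ofLp) * (b ⬝ᵥ (Z ω).ofLp) ∂μ := by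
  simp only [mul_dotProduct_mul_dotProduct]
  rw [integral_finsetSum _ fun j _ => integrable_finsetSum _ fun k _ => (hw j k).const_mul _]
  simp only [dotProduct, mulVec, momMat, of_apply, Finset.mul_sum]
  refine Finset.sum_congr rfl fun j _ => ?_
  rw [integral_finsetSum _ fun k _ => (hw j k).const_mul _]
  refine Finset.sum_congr rfl fun k _ => ?_
  rw [integral_const_mul]
  ring

lemma momVec_add {w w' : Ω → ℝ} (hw : ∀ j, Integrable (fun ω => w ω * Z ω j) μ)
    (hw' : ∀ j, Integrable (fun ω => w' ω * Z ω j) μ) :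
    momVec μ (fun ω => w ω + w' ω) Z = momVec μ w Z + momVec μ w' Z := by
  ext j
  simp only [momVec, add_mul, Pi.add_apply]
  exact integral_add (hw j) (hw' j)

lemma momVec_mul_dotProduct {w : Ω → ℝ}
    (hw : ∀ j k, Integrable (fun ω => w ω * Z ω j * Z ω k) μ) (a : Fin L → ℝ) :
    momVec μ (fun ω => w ω * ((Z ω).ofLp ⬝ᵥ a)) Z = momMat μ w Z *ᵥ a := by
  ext j
  simp only [momVec, momMat, mulVec, dotProduct, of_apply]
  have h ω : w ω * (∑ k, Z ω k * a k) * Z ω j = ∑ k, w ω * Z ω j * Z ω k * a k := by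
    rw [Finset.mul_sum, Finset.sum_mul]
    exact Finset.sum_congr rfl fun k _ => by ring
  simp only [h]
  rw [integral_finsetSum _ fun k _ => (hw j k).mul_const _]
  simp only [integral_mul_const]

lemma momMat_add {w w' : Ω → ℝ} (hw : ∀ j k, Integrable (fun ω => w ω * Z ω j * Z ω k) μ)
    (hw' : ∀ j k, Integrable (fun ω => w' ω * Z ω j * Z ω k) μ) :
    momMat μ (fun ω => w ω + w' ω) Z = momMat μ w Z + momMat μ w' Z := by
  ext j k
  simp only [momMat, add_mul, Matrix.add_apply, of_apply]
  exact integral_add (hw j k) (hw' j k)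

lemma measurable_ind {m : Ω → Bool} (hm : Measurable m) (b : Bool) :
    Measurable fun ω => ind b (m ω) :=
  (measurable_of_finite (ind b)).comp hm

lemma ind_false_add_ind_true (c : Bool) : ind false c + ind true c = 1 := by
  cases c <;> simp [ind]

lemma norm_ind_le (b c : Bool) : ‖ind b c‖ ≤ 1 := by
  cases b <;> cases c <;> simp [ind]

lemma integral_ind_mul {m : Ω → Bool} (hm : Measurable m) (b : Bool) (f : Ω → ℝ) :
    ∫ ω, ind b (m ω) * f ω ∂μ = ∫ ω in m ⁻¹' {b}, f ω ∂μ := by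
  rw [← integral_indicator (hm (measurableSet_singleton b))]
  refine integral_congr_ae (.of_forall fun ω => ?_)
  by_cases h : m ω = b <;> simp [ind, h]

variable [IsProbabilityMeasure μ]

lemma measureReal_false {m : Ω → Bool} (hm : Measurable m) :
    μ.real (m ⁻¹' {false}) = 1 - μ.real (m ⁻¹' {true}) := by
  rw [← probReal_compl_eq_one_sub (hm (measurableSet_singleton true))]
  congr 1
  ext ω
  simp

/-- The product form needs no division by the probability of the status: if the status is null both
sides vanish, which covers `p = 0`. -/
lemma measureReal_mul_integral_statusMeasure {m : Ω → Bool} (hm : Measurable m) (b : Bool)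
    (f : Ω → ℝ) :
    μ.real (m ⁻¹' {b}) * ∫ ω, f ω ∂statusMeasure μ m b = ∫ ω, ind b (m ω) * f ω ∂μ := by
  rw [integral_ind_mul hm, statusMeasure, ProbabilityTheory.cond, integral_smul_measure]
  by_cases h : μ (m ⁻¹' {b}) = 0
  · rw [setIntegral_measure_zero _ h]
    simp
  · have h' : μ.real (m ⁻¹' {b}) ≠ 0 := (measureReal_ne_zero_iff).2 h
    rw [ENNReal.toReal_inv, smul_eq_mul, ← mul_assoc]
    change μ.real (m ⁻¹' {b}) * (μ.real (m ⁻¹' {b}))⁻¹ * _ = _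
    rw [mul_inv_cancel₀ h', one_mul]

lemma smul_momMat_statusMeasure {m : Ω → Bool} (hm : Measurable m) (b : Bool) (w : Ω → ℝ) :
    μ.real (m ⁻¹' {b}) • momMat (statusMeasure μ m b) w Z =
      momMat μ (fun ω => ind b (m ω) * w ω) Z := by
  ext j k
  simp only [momMat, Matrix.smul_apply, of_apply, smul_eq_mul]
  rw [measureReal_mul_integral_statusMeasure hm]
  simp only [mul_assoc]

lemma smul_momVec_statusMeasure {m : Ω → Bool} (hm : Measurable m) (b : Bool) (w : Ω → ℝ) :
    μ.real (m ⁻¹' {b}) • momVec (statusMeasure μ m b) w Z =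
      momVec μ (fun ω => ind b (m ω) * w ω) Z := by
  ext j
  simp only [momVec, Pi.smul_apply, smul_eq_mul]
  rw [measureReal_mul_integral_statusMeasure hm]
  simp only [mul_assoc]

/-- Under an ignorable missing structure a first-stage error moment that vanishes in the population
vanishes in each status group. -/
lemma Ignorable.momVec_ind_mul_eq_zero {m : Ω → Bool} {u v : Ω → ℝ} (h : Ignorable μ m Z u v)
    (hm : Measurable m) (hv : momVec μ v Z = 0) (b : Bool) :
    momVec μ (fun ω => ind b (m ω) * v ω) Z = 0 := by
  rw [← smul_momVec_statusMeasure hm]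
  by_cases h0 : μ (m ⁻¹' {b}) = 0
  · rw [measureReal_def, h0, ENNReal.toReal_zero, zero_smul]
  · rw [(h b h0).2, hv, smul_zero]

omit [IsProbabilityMeasure μ] in
-- Symmetry of `Q` identifies `Q⁻¹ q` with `q Q⁻¹`, so both outer factors of the sandwich are the
-- 2SLS row.
lemma sandwich_eq {q : Fin L → ℝ} {Q W : Matrix (Fin L) (Fin L) ℝ} (hQ : Qᵀ = Q) :
    sandwich q Q W = tslsRow q Q ⬝ᵥ W *ᵥ tslsRow q Q := by
  have hq : Q⁻¹ *ᵥ q = q ᵥ* Q⁻¹ := by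
    rw [← mulVec_transpose, transpose_nonsing_inv, hQ]
  rw [sandwich, tslsRow, ← mulVec_mulVec, ← mulVec_mulVec, hq, dotProduct_mulVec q Q⁻¹, mulVec_smul,
    smul_dotProduct, dotProduct_smul, smul_eq_mul, smul_eq_mul]
  ring

omit [IsProbabilityMeasure μ] in
/-- A positive semidefinite matrix of second moments is positive definite if invertible. -/
lemma posDef_momMat_one (hZ : ∀ j k, Integrable (fun ω => (1 : ℝ) * Z ω j * Z ω k) μ)
    (hdet : IsUnit (momMat μ (fun _ => 1) Z).det) : (momMat μ (fun _ => 1) Z).PosDef := by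
  refine (PosSemidef.posDef_iff_isUnit ?_).2 ((isUnit_iff_isUnit_det _).2 hdet)
  refine PosSemidef.of_dotProduct_mulVec_nonneg ?_ fun a => ?_
  · rw [IsHermitian, conjTranspose_eq_transpose_of_trivial, momMat_transpose]
  · rw [star_trivial, dotProduct_momMat_mulVec hZ]
    simp only [one_mul]
    exact integral_nonneg fun ω => mul_self_nonneg _

/-- The quadratic form of `omegaRI` is the second moment of the influence function. -/
lemma dotProduct_omegaRI_mulVec {m : Ω → Bool} (hm : Measurable m) {u v : Ω → ℝ} {p β : ℝ}
    (hp : μ.real (m ⁻¹' {true}) = p) (hp1 : p < 1)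
    (hu : ∀ j, MemLp (fun ω => u ω * Z ω j) 2 μ) (hv : ∀ j, MemLp (fun ω => v ω * Z ω j) 2 μ)
    (r : Fin L → ℝ) :
    r ⬝ᵥ omegaRI μ m Z u v p β *ᵥ r =
      ∫ ω, (r ⬝ᵥ (Z ω).ofLp * (u ω + β * (ind true (m ω) * v ω)) +
        (-β • (r ᵥ* (momMat μ (fun ω => ind true (m ω)) Z *
          (momMat μ (fun ω => ind false (m ω)) Z)⁻¹))) ⬝ᵥ (Z ω).ofLp *
            (ind false (m ω) * v ω)) ^ 2 ∂μ := by
  have hp0 : μ.real (m ⁻¹' {false}) = 1 - p := by rw [measureReal_false hm, hp]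
  have hp' : 1 - p ≠ 0 := by linarith
  have hind {w : Ω → ℝ} (b : Bool) (hw : ∀ j k, Integrable (fun ω => w ω * Z ω j * Z ω k) μ)
      (j k : Fin L) : Integrable (fun ω => ind b (m ω) * w ω * Z ω j * Z ω k) μ := by
    simpa only [mul_assoc] using (hw j k).bdd_mul (c := 1)
      (measurable_ind hm b).aestronglyMeasurable (.of_forall fun ω => norm_ind_le b (m ω))
  have huu j k : Integrable (fun ω => u ω ^ 2 * Z ω j * Z ω k) μ :=
    ((hu j).integrable_mul (hu k)).congr (.of_forall fun ω => by simp; ring)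
  have huv j k : Integrable (fun ω => u ω * v ω * Z ω j * Z ω k) μ :=
    ((hu j).integrable_mul (hv k)).congr (.of_forall fun ω => by simp; ring)
  have hvv j k : Integrable (fun ω => v ω ^ 2 * Z ω j * Z ω k) μ :=
    ((hv j).integrable_mul (hv k)).congr (.of_forall fun ω => by simp; ring)
  have hform {w : Ω → ℝ} (hw : ∀ j k, Integrable (fun ω => w ω * Z ω j * Z ω k) μ)
      (a b : Fin L → ℝ) :
      Integrable (fun ω => w ω * (a ⬝ᵥ (Z ω).ofLp) * (b ⬝ᵥ (Z ω).ofLp)) μ := by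
    simp only [mul_dotProduct_mul_dotProduct]
    exact integrable_finsetSum _ fun j _ => integrable_finsetSum _ fun k _ =>
      (hw j k).const_mul _
  have hone b : momMat μ (fun ω => ind b (m ω)) Z =
      μ.real (m ⁻¹' {b}) • momMat (statusMeasure μ m b) (fun _ => 1) Z := by
    simpa only [mul_one] using (smul_momMat_statusMeasure hm b fun _ => 1).symm
  rw [hone, hone, hp, hp0, inv_smul_of_ne_zero hp']
  have hM1 := smul_momMat_statusMeasure (μ := μ) (Z := Z) hm true fun ω => u ω * v ω
  have hM0 := smul_momMat_statusMeasure (μ := μ) (Z := Z) hm false fun ω => u ω * v ω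
  have hN1 := smul_momMat_statusMeasure (μ := μ) (Z := Z) hm true fun ω => v ω ^ 2
  have hN0 := smul_momMat_statusMeasure (μ := μ) (Z := Z) hm false fun ω => v ω ^ 2
  rw [hp] at hM1 hN1
  rw [hp0] at hM0 hN0
  rw [omegaRI]
  have hT0 := momMat_transpose (μ := statusMeasure μ m false) (Z := Z) fun _ => 1
  have hT1 := momMat_transpose (μ := statusMeasure μ m true) (Z := Z) fun _ => 1
  generalize momMat (statusMeasure μ m true) (fun _ => 1) Z = Q₁ at *
  generalize momMat (statusMeasure μ m false) (fun _ => 1) Z = Q₀ at *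
  obtain ⟨t, ht⟩ : ∃ t, t = r ᵥ* (Q₁ * Q₀⁻¹) := ⟨_, rfl⟩
  have ht' : (Q₀⁻¹ * Q₁) *ᵥ r = t := by
    rw [ht, ← mulVec_transpose, transpose_mul, transpose_nonsing_inv, hT0, hT1]
  -- The factor is that of `-β (p Q₁) ((1 - p) Q₀)⁻¹`. Against the weight `1 - p` of the observed
  -- moments it yields `-2pβ` in the cross term and `p² β² / (1 - p)` in the square.
  obtain ⟨s, hs⟩ : ∃ s : Fin L → ℝ, s = -(β * p / (1 - p)) • t := ⟨_, rfl⟩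
  have hs' : -β • (r ᵥ* (p • Q₁ * (1 - p)⁻¹ • Q₀⁻¹)) = s := by
    rw [smul_mul_smul_comm, vecMul_smul, ← ht, hs, smul_smul]
    congr 1
    field_simp
  rw [hs']
  have e1 := dotProduct_momMat_mulVec huu r r
  have e2 := dotProduct_momMat_mulVec (hind false huv) r s
  have e3 := dotProduct_momMat_mulVec (hind false hvv) s s
  have e4 := dotProduct_momMat_mulVec (hind true huv) r r
  have e5 := dotProduct_momMat_mulVec (hind true hvv) r r
  have i1 := hform huu r r
  have i2 := (hform (hind false huv) r s).const_mul 2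
  have i3 := hform (hind false hvv) s s
  have i4 := (hform (hind true huv) r r).const_mul (2 * β)
  have i5 := (hform (hind true hvv) r r).const_mul (β ^ 2)
  -- The indicators are idempotent with product `0`, so no term mixes the observed and the missing
  -- `v`; the five terms left match those of `omegaRI`.
  have hsq : ∀ ω, (r ⬝ᵥ (Z ω).ofLp * (u ω + β * (ind true (m ω) * v ω)) +
        s ⬝ᵥ (Z ω).ofLp * (ind false (m ω) * v ω)) ^ 2 =
      u ω ^ 2 * (r ⬝ᵥ (Z ω).ofLp) * (r ⬝ᵥ (Z ω).ofLp) +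
      2 * (ind false (m ω) * (u ω * v ω) * (r ⬝ᵥ (Z ω).ofLp) * (s ⬝ᵥ (Z ω).ofLp)) +
      ind false (m ω) * v ω ^ 2 * (s ⬝ᵥ (Z ω).ofLp) * (s ⬝ᵥ (Z ω).ofLp) +
      2 * β * (ind true (m ω) * (u ω * v ω) * (r ⬝ᵥ (Z ω).ofLp) * (r ⬝ᵥ (Z ω).ofLp)) +
      β ^ 2 * (ind true (m ω) * v ω ^ 2 * (r ⬝ᵥ (Z ω).ofLp) * (r ⬝ᵥ (Z ω).ofLp)) := fun ω => by
    cases m ω <;> simp [ind] <;> ring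
  simp only [hsq]
  rw [integral_add, integral_add, integral_add, integral_add i1 i2, integral_const_mul, integral_const_mul,
    integral_const_mul, ← e1, ← e2, ← e3, ← e4, ← e5, ← hM0, ← hM1, ← hN0, ← hN1]
  generalize momMat (statusMeasure μ m false) (fun ω => u ω * v ω) Z = M₀
  generalize momMat (statusMeasure μ m true) (fun ω => u ω * v ω) Z = M₁
  generalize momMat (statusMeasure μ m false) (fun ω => v ω ^ 2) Z = N₀
  generalize momMat (statusMeasure μ m true) (fun ω => v ω ^ 2) Z = N₁
  have f2 : r ⬝ᵥ (M₀ * Q₀⁻¹ * Q₁) *ᵥ r = r ⬝ᵥ M₀ *ᵥ t := by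
    rw [Matrix.mul_assoc, ← mulVec_mulVec, ht']
  have f3 : r ⬝ᵥ (Q₁ * Q₀⁻¹ * N₀ * Q₀⁻¹ * Q₁) *ᵥ r = t ⬝ᵥ N₀ *ᵥ t := by
    rw [Matrix.mul_assoc, ← mulVec_mulVec, ht', ← mulVec_mulVec, dotProduct_mulVec, ← ht]
  simp only [add_mulVec, sub_mulVec, smul_mulVec, dotProduct_add, dotProduct_sub, dotProduct_smul,
    smul_eq_mul, f2, f3, hs, mulVec_smul, smul_dotProduct]
  · field_simp
    ring
  exacts [i1.add i2, i3, (i1.add i2).add i3, i4, ((i1.add i2).add i3).add i4, i5]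

end Population

/-! ### Sample moments -/

section SampleMoments

variable {Ω T : Type*} {L : ℕ}

/-- The sample moment matrix `n⁻¹ ∑ wᵢ Zᵢ Zᵢ'`. -/
noncomputable def empMat (ξ : ℕ → Ω → T) (ζ : T → EuclideanSpace ℝ (Fin L)) (w : T → ℝ) (n : ℕ)
    (ω : Ω) : Matrix (Fin L) (Fin L) ℝ :=
  Matrix.of fun j k => empMean ξ (fun t => w t * ζ t j * ζ t k) n ω

/-- The sample moment vector `n⁻¹ ∑ wᵢ Zᵢ`. -/
noncomputable def empVec (ξ : ℕ → Ω → T) (ζ : T → EuclideanSpace ℝ (Fin L)) (w : T → ℝ) (n : ℕ)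
    (ω : Ω) : Fin L → ℝ :=
  fun j => empMean ξ (fun t => w t * ζ t j) n ω

lemma empMean_add (ξ : ℕ → Ω → T) (f g : T → ℝ) (n : ℕ) (ω : Ω) :
    empMean ξ (fun t => f t + g t) n ω = empMean ξ f n ω + empMean ξ g n ω := by
  simp only [empMean, Finset.sum_add_distrib, mul_add]

lemma empMean_const_mul (ξ : ℕ → Ω → T) (a : ℝ) (f : T → ℝ) (n : ℕ) (ω : Ω) :
    empMean ξ (fun t => a * f t) n ω = a * empMean ξ f n ω := by
  simp only [empMean, ← Finset.mul_sum]
  ring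

lemma empMean_sum {ι : Type*} (s : Finset ι) (ξ : ℕ → Ω → T) (f : ι → T → ℝ) (n : ℕ) (ω : Ω) :
    empMean ξ (fun t => ∑ k ∈ s, f k t) n ω = ∑ k ∈ s, empMean ξ (f k) n ω := by
  simp only [empMean, Finset.mul_sum]
  exact Finset.sum_comm

variable (ξ : ℕ → Ω → T) (ζ : T → EuclideanSpace ℝ (Fin L)) (n : ℕ) (ω : Ω)

lemma empVec_add (f g : T → ℝ) :
    empVec ξ ζ (fun t => f t + g t) n ω = empVec ξ ζ f n ω + empVec ξ ζ g n ω := by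
  ext j
  simp only [empVec, add_mul, Pi.add_apply, empMean_add]

lemma empVec_const_mul (a : ℝ) (f : T → ℝ) :
    empVec ξ ζ (fun t => a * f t) n ω = a • empVec ξ ζ f n ω := by
  ext j
  simp only [empVec, mul_assoc, Pi.smul_apply, empMean_const_mul, smul_eq_mul]

lemma empVec_mul_dotProduct (w : T → ℝ) (a : Fin L → ℝ) :
    empVec ξ ζ (fun t => w t * ((ζ t).ofLp ⬝ᵥ a)) n ω = empMat ξ ζ w n ω *ᵥ a := by
  ext j
  have h t : w t * ((ζ t).ofLp ⬝ᵥ a) * ζ t j = ∑ k, a k * (w t * ζ t j * ζ t k) := by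
    rw [dotProduct, Finset.mul_sum, Finset.sum_mul]
    exact Finset.sum_congr rfl fun k _ => by ring
  simp only [empVec, h]
  simp only [empMat, mulVec, dotProduct, of_apply]
  rw [empMean_sum]
  exact Finset.sum_congr rfl fun k _ => by rw [empMean_const_mul, mul_comm]

variable {n}

lemma gram_eq_smul_empMat (hn : n ≠ 0) (w : T → ℝ) :
    gram (fun i : Fin n => w (ξ i ω)) (Matrix.of fun (i : Fin n) j => ζ (ξ i ω) j) =
      (n : ℝ) • empMat ξ ζ w n ω := by
  have hn' : (n : ℝ) ≠ 0 := Nat.cast_ne_zero.2 hn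
  ext j k
  simp only [gram, of_apply, empMat, Matrix.smul_apply, smul_eq_mul, empMean]
  rw [mul_inv_cancel_left₀ hn',
    Fin.sum_univ_eq_sum_range (fun i => w (ξ i ω) * ζ (ξ i ω) j * ζ (ξ i ω) k)]

lemma cross_eq_smul_empVec (hn : n ≠ 0) (w : T → ℝ) :
    cross (fun i : Fin n => w (ξ i ω)) (Matrix.of fun (i : Fin n) j => ζ (ξ i ω) j) =
      (n : ℝ) • empVec ξ ζ w n ω := by
  have hn' : (n : ℝ) ≠ 0 := Nat.cast_ne_zero.2 hn
  ext j
  simp only [cross, of_apply, empVec, Pi.smul_apply, smul_eq_mul, empMean]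
  rw [mul_inv_cancel_left₀ hn', Fin.sum_univ_eq_sum_range (fun i => w (ξ i ω) * ζ (ξ i ω) j)]

/-- The 2SLS row is homogeneous of degree `-1` and the outcome cross moment of degree `1`, so the
factors `n` cancel. -/
lemma betaRI_eq_empVec (hn : n ≠ 0) (m : T → Bool) (x y : T → ℝ) :
    betaRI (fun i : Fin n => m (ξ i ω)) (Matrix.of fun (i : Fin n) j => ζ (ξ i ω) j)
        (fun i : Fin n => x (ξ i ω)) (fun i : Fin n => y (ξ i ω)) =
      tslsRow (impCross (empVec ξ ζ (fun t => ind false (m t) * x t) n ω)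
        (empMat ξ ζ (fun t => ind false (m t)) n ω) (empMat ξ ζ (fun t => ind true (m t)) n ω))
        (empMat ξ ζ (fun _ => 1) n ω) ⬝ᵥ empVec ξ ζ y n ω := by
  have hn' : (n : ℝ) ≠ 0 := Nat.cast_ne_zero.2 hn
  rw [betaRI_eq, cross_eq_smul_empVec ξ ζ ω hn y,
    cross_eq_smul_empVec ξ ζ ω hn fun t => ind false (m t) * x t,
    gram_eq_smul_empMat ξ ζ ω hn fun _ => 1, gram_eq_smul_empMat ξ ζ ω hn fun t => ind false (m t),
    gram_eq_smul_empMat ξ ζ ω hn fun t => ind true (m t), impCross_smul hn', tslsRow_smul hn',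
    smul_dotProduct, dotProduct_smul, smul_smul, inv_mul_cancel₀ hn', one_smul]

end SampleMoments

/-! ### Measurability and almost sure limits of the sample moments -/

section SampleLimits

variable {Ω T : Type*} [MeasurableSpace Ω] [MeasurableSpace T] {L : ℕ} {ξ : ℕ → Ω → T}
  {ζ : T → EuclideanSpace ℝ (Fin L)} {w : T → ℝ}

lemma measurable_empMat (hξ : ∀ i, Measurable (ξ i)) (hζ : Measurable ζ) (hw : Measurable w)
    (n : ℕ) (j k : Fin L) : Measurable fun ω => empMat ξ ζ w n ω j k :=
  measurable_empMean hξ (g := fun t => w t * ζ t j * ζ t k) (by fun_prop) n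

lemma measurable_empVec (hξ : ∀ i, Measurable (ξ i)) (hζ : Measurable ζ) (hw : Measurable w)
    (n : ℕ) (j : Fin L) : Measurable fun ω => empVec ξ ζ w n ω j :=
  measurable_empMean hξ (g := fun t => w t * ζ t j) (by fun_prop) n

variable {μ : Measure Ω}

lemma ae_tendsto_empMat (hindep : iIndepFun ξ μ) (hident : ∀ i, IdentDistrib (ξ i) (ξ 0) μ μ)
    (hζ : Measurable ζ) (hw : Measurable w)
    (hint : ∀ j k, Integrable (fun ω => w (ξ 0 ω) * ζ (ξ 0 ω) j * ζ (ξ 0 ω) k) μ) :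
    ∀ᵐ ω ∂μ, Tendsto (fun n => empMat ξ ζ w n ω) atTop
      (𝓝 (momMat μ (fun ω => w (ξ 0 ω)) fun ω => ζ (ξ 0 ω))) := by
  have h j k := ae_tendsto_empMean hindep hident (g := fun t => w t * ζ t j * ζ t k)
    (by fun_prop) (hint j k)
  filter_upwards [ae_all_iff.2 fun j => ae_all_iff.2 (h j)] with ω hω
  exact tendsto_pi_nhds.2 fun j => tendsto_pi_nhds.2 (hω j)

lemma ae_tendsto_empVec (hindep : iIndepFun ξ μ) (hident : ∀ i, IdentDistrib (ξ i) (ξ 0) μ μ)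
    (hζ : Measurable ζ) (hw : Measurable w)
    (hint : ∀ j, Integrable (fun ω => w (ξ 0 ω) * ζ (ξ 0 ω) j) μ) :
    ∀ᵐ ω ∂μ, Tendsto (fun n => empVec ξ ζ w n ω) atTop
      (𝓝 (momVec μ (fun ω => w (ξ 0 ω)) fun ω => ζ (ξ 0 ω))) := by
  have h j := ae_tendsto_empMean hindep hident (g := fun t => w t * ζ t j) (by fun_prop) (hint j)
  filter_upwards [ae_all_iff.2 h] with ω hω
  exact tendsto_pi_nhds.2 hω

/-- The probability limit of the fraction of missings is the probability of a missing. -/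
lemma measureReal_eq_of_tendstoInMeasure [IsProbabilityMeasure μ] (hξ : ∀ i, Measurable (ξ i))
    (hindep : iIndepFun ξ μ) (hident : ∀ i, IdentDistrib (ξ i) (ξ 0) μ μ) {m : T → Bool}
    (hm : Measurable m) {p : ℝ}
    (hp : TendstoInMeasure μ
      (fun (n : ℕ) ω => (((Finset.range n).filter fun i => m (ξ i ω) = true).card : ℝ) / (n : ℝ))
      atTop (fun _ => p)) :
    μ.real ((fun ω => m (ξ 0 ω)) ⁻¹' {true}) = p := by
  have hmean n ω : empMean ξ (fun t => ind true (m t)) n ω =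
      (((Finset.range n).filter fun i => m (ξ i ω) = true).card : ℝ) / (n : ℝ) := by
    simp only [empMean, ind, Finset.sum_boole]
    ring
  have hint : ∫ ω, ind true (m (ξ 0 ω)) ∂μ = μ.real ((fun ω => m (ξ 0 ω)) ⁻¹' {true}) := by
    have := integral_ind_mul (μ := μ) (hm.comp (hξ 0)) true fun _ => 1
    simpa using! this
  have hlim : TendstoInMeasure μ (fun n ω => empMean ξ (fun t => ind true (m t)) n ω) atTop
      fun _ => μ.real ((fun ω => m (ξ 0 ω)) ⁻¹' {true}) := by
    refine tendstoInMeasure_of_tendsto_ae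
      (fun n => (measurable_empMean hξ (measurable_ind hm true) n).aestronglyMeasurable) ?_
    rw [← hint]
    refine ae_tendsto_empMean hindep hident (measurable_ind hm true) ?_
    exact .of_bound ((measurable_ind hm true).comp (hξ 0)).aestronglyMeasurable 1
      (.of_forall fun ω => norm_ind_le _ _)
  simp only [hmean] at hlim
  -- The two constant limits agree almost everywhere, hence at some point, the measure being a
  -- probability.
  exact (tendstoInMeasure_ae_unique hlim hp).exists.choose_spec

lemma memLp_four_mul {f g : Ω → ℝ} (hf : MemLp f 4 μ) (hg : MemLp g 4 μ) :
    MemLp (fun ω => f ω * g ω) 2 μ := by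
  have : ENNReal.HolderTriple 4 4 2 := ⟨by
    rw [← ENNReal.toReal_eq_toReal_iff' (by simp) (by simp), ENNReal.toReal_add (by simp) (by simp)]
    norm_num⟩
  exact hg.mul' hf

end SampleLimits

end RegImp

/-! ### Asymptotic normality of the estimator -/

set_option maxHeartbeats 1600000 in
theorem proposition1 {Ω : Type*} [MeasurableSpace Ω] (μ : Measure Ω) [IsProbabilityMeasure μ]
    {L : ℕ} (β p : ℝ) (π : Fin L → ℝ)
    (Z : ℕ → Ω → EuclideanSpace ℝ (Fin L)) (x y u v : ℕ → Ω → ℝ) (m : ℕ → Ω → Bool)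
    (hZm : ∀ i, Measurable (Z i)) (hxm : ∀ i, Measurable (x i)) (hym : ∀ i, Measurable (y i))
    (hmm : ∀ i, Measurable (m i))
    -- the model
    (hy : ∀ i ω, y i ω = x i ω * β + u i ω)
    (hx : ∀ i ω, x i ω = (Z i ω).ofLp ⬝ᵥ π + v i ω)
    -- i.i.d. observations, the missing status being part of an observation
    (hindep : iIndepFun (fun i ω => (y i ω, x i ω, Z i ω, m i ω)) μ)
    (hident : ∀ i, IdentDistrib (fun ω => (y i ω, x i ω, Z i ω, m i ω))
      (fun ω => (y 0 ω, x 0 ω, Z 0 ω, m 0 ω)) μ μ)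
    -- finite moments; the third line is about the imputed regressor with the population coefficient,
    -- the last one says that `E[v₁² Z₁ Z₁']` is finite
    (hy4 : MemLp (y 0) 4 μ)
    (hZ4 : MemLp (Z 0) 4 μ)
    (hx4 : MemLp (fun ω => if m 0 ω = true then (Z 0 ω).ofLp ⬝ᵥ π else x 0 ω) 4 μ)
    (hv1 : ∀ j, IntegrableOn (fun ω => v 0 ω ^ 2 * Z 0 ω j ^ 2) (m 0 ⁻¹' {true}) μ)
    -- instrument validity, relevance and full rank
    (hZu : RegImp.momVec μ (u 0) (Z 0) = 0)
    (hZv : RegImp.momVec μ (v 0) (Z 0) = 0)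
    (hQZx : RegImp.momVec μ (x 0) (Z 0) ≠ 0)
    (hQZZ : IsUnit (RegImp.momMat μ (fun _ => 1) (Z 0)).det)
    (hQ00 : IsUnit (RegImp.momMat (RegImp.statusMeasure μ (m 0) false) (fun _ => 1) (Z 0)).det)
    -- the fraction of missings converges to `p < 1`, and the missing structure is ignorable
    (hp : TendstoInMeasure μ
      (fun (n : ℕ) ω => (((Finset.range n).filter fun i => m i ω = true).card : ℝ) / (n : ℝ))
      atTop (fun _ => p))
    (hp1 : p < 1)
    (hign : RegImp.Ignorable μ (m 0) (Z 0) (u 0) (v 0)) :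
    0 ≤ RegImp.asymVar μ (m 0) (Z 0) (x 0) (u 0) (v 0) p β ∧
    TendstoInDistribution
      (fun (n : ℕ) ω => √(n : ℝ) *
        (RegImp.betaRI (fun i : Fin n => m i ω) (Matrix.of fun (i : Fin n) j => Z i ω j)
          (fun i : Fin n => x i ω) (fun i : Fin n => y i ω) - β))
      atTop (id : ℝ → ℝ) (fun _ => μ)
      (gaussianReal 0 (RegImp.asymVar μ (m 0) (Z 0) (x 0) (u 0) (v 0) p β).toNNReal) := by
  -- the observations as a sequence of points of a product space, and the model on that space
  set ξ : ℕ → Ω → ℝ × ℝ × EuclideanSpace ℝ (Fin L) × Bool :=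
    fun i ω => (y i ω, x i ω, Z i ω, m i ω) with hξdef
  let Y : ℝ × ℝ × EuclideanSpace ℝ (Fin L) × Bool → ℝ := fun t => t.1
  let X : ℝ × ℝ × EuclideanSpace ℝ (Fin L) × Bool → ℝ := fun t => t.2.1
  let ζ : ℝ × ℝ × EuclideanSpace ℝ (Fin L) × Bool → EuclideanSpace ℝ (Fin L) := fun t => t.2.2.1
  let M : ℝ × ℝ × EuclideanSpace ℝ (Fin L) × Bool → Bool := fun t => t.2.2.2
  let V : ℝ × ℝ × EuclideanSpace ℝ (Fin L) × Bool → ℝ := fun t => X t - (ζ t).ofLp ⬝ᵥ π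
  let D : Bool → ℝ × ℝ × EuclideanSpace ℝ (Fin L) × Bool → ℝ := fun b t => RegImp.ind b (M t)
  -- The composite error `y - β x*`: replacing a missing `x` by `Z'π` moves `β v` into the error.
  let E : ℝ × ℝ × EuclideanSpace ℝ (Fin L) × Bool → ℝ :=
    fun t => Y t - X t * β + β * (D true t * V t)
  have hξm i : Measurable (ξ i) := (hym i).prodMk ((hxm i).prodMk ((hZm i).prodMk (hmm i)))
  have hYm : Measurable Y := measurable_fst
  have hXm : Measurable X := measurable_fst.comp measurable_snd
  have hζm : Measurable ζ := measurable_fst.comp (measurable_snd.comp measurable_snd)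
  have hMm : Measurable M := measurable_snd.comp (measurable_snd.comp measurable_snd)
  have hDm b : Measurable (D b) := RegImp.measurable_ind hMm b
  have hVm : Measurable V := by
    simp only [V, dotProduct]
    fun_prop
  have hEm : Measurable E := by fun_prop
  have hVξ ω : V (ξ 0 ω) = v 0 ω := by
    simp only [V, X, ζ, ξ, hx 0 ω]
    ring
  have hEξ ω : E (ξ 0 ω) = u 0 ω + β * (RegImp.ind true (m 0 ω) * v 0 ω) := by
    have h1 : Y (ξ 0 ω) - X (ξ 0 ω) * β = u 0 ω := by
      simp only [X, Y, ξ, hy 0 ω]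
      ring
    simp only [E, h1, hVξ]
    rfl
  have hvm : Measurable (v 0) := by
    have : v 0 = fun ω => V (ξ 0 ω) := funext fun ω => (hVξ ω).symm
    rw [this]
    exact hVm.comp (hξm 0)
  -- moments
  have hZj j : MemLp (fun ω => Z 0 ω j) 4 μ :=
    hZ4.of_le (by fun_prop) (.of_forall fun ω => PiLp.norm_apply_le (Z 0 ω) j)
  have hZπ : MemLp (fun ω => (Z 0 ω).ofLp ⬝ᵥ π) 4 μ := by
    simp only [dotProduct]
    exact memLp_finsetSum _ fun j _ => (hZj j).mul_const _
  -- Only `y`, `Z` and `x*` have fourth moments, so the errors are reached through `1{m=0} v = x* -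
  -- Z'π` here and `u + β 1{m=1} v = y - β x*` next.
  have hv0 : MemLp (fun ω => RegImp.ind false (m 0 ω) * v 0 ω) 4 μ := by
    refine (hx4.sub hZπ).ae_eq (.of_forall fun ω => ?_)
    rcases h : m 0 ω <;> simp [h, RegImp.ind, hx 0 ω]
  have hE : MemLp (fun ω => u 0 ω + β * (RegImp.ind true (m 0 ω) * v 0 ω)) 4 μ := by
    refine (hy4.sub (hx4.const_mul β)).ae_eq (.of_forall fun ω => ?_)
    rcases h : m 0 ω <;> simp [h, RegImp.ind, hy 0 ω, hx 0 ω] <;> ring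
  have hv0Z j : MemLp (fun ω => RegImp.ind false (m 0 ω) * v 0 ω * Z 0 ω j) 2 μ :=
    RegImp.memLp_four_mul hv0 (hZj j)
  have hEZ j : MemLp (fun ω => (u 0 ω + β * (RegImp.ind true (m 0 ω) * v 0 ω)) * Z 0 ω j) 2 μ :=
    RegImp.memLp_four_mul hE (hZj j)
  -- Nothing above controls `v` by itself on missing rows; `hv1` does, and thereby separates `u`
  -- from `v` there.
  have hv1Z j : MemLp (fun ω => RegImp.ind true (m 0 ω) * v 0 ω * Z 0 ω j) 2 μ := by
    have hmeas : Measurable fun ω => RegImp.ind true (m 0 ω) * v 0 ω * Z 0 ω j := by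
      have := RegImp.measurable_ind (hmm 0) true
      fun_prop
    rw [memLp_two_iff_integrable_sq hmeas.aestronglyMeasurable]
    refine ((hv1 j).integrable_indicator (hmm 0 (measurableSet_singleton true))).congr
      (.of_forall fun ω => ?_)
    by_cases h : m 0 ω = true <;> simp [RegImp.ind, h, mul_pow]
  have hvZ j : MemLp (fun ω => v 0 ω * Z 0 ω j) 2 μ :=
    ((hv0Z j).add (hv1Z j)).ae_eq (.of_forall fun ω => by
      rw [Pi.add_apply, ← add_mul, ← add_mul, RegImp.ind_false_add_ind_true, one_mul])
  have huZ j : MemLp (fun ω => u 0 ω * Z 0 ω j) 2 μ :=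
    ((hEZ j).sub ((hv1Z j).const_mul β)).ae_eq (.of_forall fun ω => by
      simp only [Pi.sub_apply]
      ring)
  have hZZ j k : Integrable (fun ω => (1 : ℝ) * Z 0 ω j * Z 0 ω k) μ := by
    simpa only [one_mul] using
      (RegImp.memLp_four_mul (hZj j) (hZj k)).integrable one_le_two
  have hDZZ b j k : Integrable (fun ω => RegImp.ind b (m 0 ω) * Z 0 ω j * Z 0 ω k) μ := by
    simpa only [one_mul, mul_assoc] using (hZZ j k).bdd_mul (c := 1)
      (RegImp.measurable_ind (hmm 0) b).aestronglyMeasurable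
      (.of_forall fun ω => RegImp.norm_ind_le b (m 0 ω))
  have hZπZ b j :
      Integrable (fun ω => RegImp.ind b (m 0 ω) * ((Z 0 ω).ofLp ⬝ᵥ π) * Z 0 ω j) μ := by
    simpa only [mul_assoc] using
      ((RegImp.memLp_four_mul hZπ (hZj j)).integrable one_le_two).bdd_mul (c := 1)
      (RegImp.measurable_ind (hmm 0) b).aestronglyMeasurable
      (.of_forall fun ω => RegImp.norm_ind_le b (m 0 ω))
  -- population moments
  have hpm : μ.real (m 0 ⁻¹' {true}) = p :=
    RegImp.measureReal_eq_of_tendstoInMeasure hξm hindep hident hMm hp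
  have hVmean b : RegImp.momVec μ (fun ω => RegImp.ind b (m 0 ω) * v 0 ω) (Z 0) = 0 :=
    hign.momVec_ind_mul_eq_zero (hmm 0) hZv b
  set Q := RegImp.momMat μ (fun _ => 1) (Z 0) with hQ
  set Q₀ := RegImp.momMat μ (fun ω => RegImp.ind false (m 0 ω)) (Z 0) with hQ0
  set Q₁ := RegImp.momMat μ (fun ω => RegImp.ind true (m 0 ω)) (Z 0) with hQ1
  have hQsum : Q₀ + Q₁ = Q := by
    rw [hQ0, hQ1, ← RegImp.momMat_add (hDZZ false) (hDZZ true)]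
    simp only [RegImp.ind_false_add_ind_true, hQ]
  have hQ0det : IsUnit Q₀.det := by
    have := RegImp.smul_momMat_statusMeasure (μ := μ) (Z := Z 0) (hmm 0) false fun _ => 1
    simp only [mul_one] at this
    rw [hQ0, ← this, RegImp.measureReal_false (hmm 0), hpm, det_smul]
    exact ((isUnit_iff_ne_zero.2 (by linarith)).pow _).mul hQ00
  have hq : RegImp.momVec μ (x 0) (Z 0) = Q *ᵥ π := by
    have h1 : x 0 = fun ω => 1 * ((Z 0 ω).ofLp ⬝ᵥ π) + v 0 ω :=
      funext fun ω => by rw [hx 0 ω, one_mul]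
    rw [h1, RegImp.momVec_add _ fun j => (hvZ j).integrable one_le_two, hZv, add_zero,
      RegImp.momVec_mul_dotProduct hZZ]
    intro j
    simpa only [one_mul] using (RegImp.memLp_four_mul hZπ (hZj j)).integrable one_le_two
  have hD0 : (Q *ᵥ π) ⬝ᵥ Q⁻¹ *ᵥ (Q *ᵥ π) ≠ 0 := by
    rw [hq] at hQZx
    simpa using ((RegImp.posDef_momMat_one hZZ hQZZ).inv.dotProduct_mulVec_pos hQZx).ne'
  have hcross : RegImp.momVec μ (fun ω => RegImp.ind false (m 0 ω) * x 0 ω) (Z 0) = Q₀ *ᵥ π := by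
    have h1 : (fun ω => RegImp.ind false (m 0 ω) * x 0 ω) = fun ω =>
        RegImp.ind false (m 0 ω) * ((Z 0 ω).ofLp ⬝ᵥ π) + RegImp.ind false (m 0 ω) * v 0 ω :=
      funext fun ω => by rw [hx 0 ω, mul_add]
    rw [h1, RegImp.momVec_add (hZπZ false) fun j => (hv0Z j).integrable one_le_two, hVmean,
      add_zero, RegImp.momVec_mul_dotProduct (hDZZ false)]
  -- Imputation leaves the limiting first stage unchanged: `Q₀ π + Q₁ π` is the full-data cross
  -- moment, so relevance carries over.
  have himp : RegImp.impCross (Q₀ *ᵥ π) Q₀ Q₁ = Q *ᵥ π := by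
    rw [RegImp.impCross, mulVec_mulVec π Q₀⁻¹, nonsing_inv_mul _ hQ0det, one_mulVec, ← add_mulVec,
      hQsum]
  -- the variance
  obtain ⟨r, hr⟩ : ∃ r, r = RegImp.tslsRow (Q *ᵥ π) Q := ⟨_, rfl⟩
  obtain ⟨s, hs⟩ : ∃ s, s = -β • (r ᵥ* (Q₁ * Q₀⁻¹)) := ⟨_, rfl⟩
  have hvar : RegImp.asymVar μ (m 0) (Z 0) (x 0) (u 0) (v 0) p β =
      ∫ ω, (r ⬝ᵥ (Z 0 ω).ofLp * (u 0 ω + β * (RegImp.ind true (m 0 ω) * v 0 ω)) +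
        s ⬝ᵥ (Z 0 ω).ofLp * (RegImp.ind false (m 0 ω) * v 0 ω)) ^ 2 ∂μ := by
    rw [RegImp.asymVar, RegImp.sandwich_eq (RegImp.momMat_transpose _), hq, ← hQ, ← hr,
      RegImp.dotProduct_omegaRI_mulVec (hmm 0) hpm hp1 huZ hvZ, hs, hQ0, hQ1]
  refine ⟨by rw [hvar]; exact integral_nonneg fun ω => sq_nonneg _, ?_⟩
  -- the estimator as a function of sample moments
  let c : ℕ → Ω → Fin L → ℝ := RegImp.empVec ξ ζ fun t => D false t * X t
  let G : ℕ → Ω → Matrix (Fin L) (Fin L) ℝ := RegImp.empMat ξ ζ fun _ => 1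
  let G₀ : ℕ → Ω → Matrix (Fin L) (Fin L) ℝ := RegImp.empMat ξ ζ (D false)
  let G₁ : ℕ → Ω → Matrix (Fin L) (Fin L) ℝ := RegImp.empMat ξ ζ (D true)
  let h : ℕ → Ω → Fin L → ℝ := fun n ω => RegImp.impCross (c n ω) (G₀ n ω) (G₁ n ω)
  let R : ℕ → Ω → Fin L → ℝ := fun n ω => RegImp.tslsRow (h n ω) (G n ω)
  let S : ℕ → Ω → Fin L → ℝ := fun n ω => -β • (R n ω ᵥ* (G₁ n ω * (G₀ n ω)⁻¹))
  have hbeta n ω (hn : n ≠ 0) :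
      RegImp.betaRI (fun i : Fin n => m i ω) (Matrix.of fun (i : Fin n) j => Z i ω j)
        (fun i : Fin n => x i ω) (fun i : Fin n => y i ω) =
      R n ω ⬝ᵥ RegImp.empVec ξ ζ Y n ω :=
    RegImp.betaRI_eq_empVec ξ ζ ω hn M X Y
  have hGm n := RegImp.measurable_empMat (w := fun _ => 1) hξm hζm measurable_const n
  have hG₀m n := RegImp.measurable_empMat hξm hζm (hDm false) n
  have hG₁m n := RegImp.measurable_empMat hξm hζm (hDm true) n
  have hRm n : ∀ j, Measurable fun ω => R n ω j :=
    RegImp.measurable_tslsRow (RegImp.measurable_impCross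
      (RegImp.measurable_empVec hξm hζm ((hDm false).mul hXm) n) (hG₀m n) (hG₁m n)) (hGm n)
  have hSm n j : Measurable fun ω => S n ω j :=
    (RegImp.measurable_vecMul (RegImp.measurable_matrix_mul (hG₁m n)
      (RegImp.measurable_matrix_inv (hG₀m n))) (hRm n) j).const_mul (-β)
  have hlim : ∀ᵐ ω ∂μ, (∀ᶠ n in atTop, IsUnit (G₀ n ω).det) ∧
      (∀ᶠ n in atTop, h n ω ⬝ᵥ (G n ω)⁻¹ *ᵥ h n ω ≠ 0) ∧
      Tendsto (fun n => R n ω) atTop (𝓝 r) ∧ Tendsto (fun n => S n ω) atTop (𝓝 s) := by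
    filter_upwards [
      RegImp.ae_tendsto_empMat (w := fun _ => 1) hindep hident hζm measurable_const hZZ,
      RegImp.ae_tendsto_empMat hindep hident hζm (hDm false) (hDZZ false),
      RegImp.ae_tendsto_empMat hindep hident hζm (hDm true) (hDZZ true),
      RegImp.ae_tendsto_empVec (w := fun t => D false t * X t) hindep hident hζm
        ((hDm false).mul hXm) fun j => by
          refine ((hZπZ false j).add ((hv0Z j).integrable one_le_two)).congr
            (.of_forall fun ω => ?_)
          simp only [Pi.add_apply, D, X, M, ζ, ξ, hx 0 ω]
          ring] with ω hG hG₀ hG₁ hc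
    have hc' : Tendsto (fun n => c n ω) atTop (𝓝 (Q₀ *ᵥ π)) := hcross ▸ hc
    have hh : Tendsto (fun n => h n ω) atTop (𝓝 (Q *ᵥ π)) :=
      himp ▸ RegImp.tendsto_impCross hc' hG₀ hG₁ hQ0det
    have hR : Tendsto (fun n => R n ω) atTop (𝓝 r) :=
      hr ▸ RegImp.tendsto_tslsRow hh hG hQZZ hD0
    refine ⟨?_, (RegImp.tendsto_firstStage_form hh hG hQZZ).eventually_ne hD0, hR, ?_⟩
    · have := (continuous_id.matrix_det.tendsto Q₀).comp hG₀
      filter_upwards [this.eventually_ne hQ0det.ne_zero] with n hn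
      exact isUnit_iff_ne_zero.2 hn
    · rw [hs]
      refine (RegImp.tendsto_vecMul ?_ hR).const_smul (-β)
      exact ((continuous_fst.matrix_mul continuous_snd).tendsto (Q₁, Q₀⁻¹)).comp
        (hG₁.prodMk_nhds (RegImp.tendsto_matrix_inv hG₀ hQ0det))
  -- the central limit theorem
  let g : Fin L ⊕ Fin L → ℝ × ℝ × EuclideanSpace ℝ (Fin L) × Bool → ℝ :=
    Sum.elim (fun j t => E t * ζ t j) (fun j t => D false t * V t * ζ t j)
  have hvar' : RegImp.asymVar μ (m 0) (Z 0) (x 0) (u 0) (v 0) p β =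
      ∫ ω, (∑ k, Sum.elim r s k * g k (ξ 0 ω)) ^ 2 ∂μ := by
    rw [hvar]
    refine integral_congr_ae (.of_forall fun ω => congrArg (· ^ 2) ?_)
    simp only [g, Fintype.sum_sum_type, Sum.elim_inl, Sum.elim_inr, hEξ, hVξ, dotProduct,
      Finset.sum_mul]
    congr 1 <;> refine Finset.sum_congr rfl fun j _ => ?_ <;> simp only [ζ, D, M, ξ] <;> ring
  rw [hvar']
  refine RegImp.tendstoInDistribution_of_ae_eventually_eq_sum
    (C := fun n ω => Sum.elim (R n ω) (S n ω)) hξm hindep hident ?_ ?_ ?_ ?_ ?_ ?_ ?_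
  · rintro (j | j)
    · simp only [g, Sum.elim_inl]
      fun_prop
    · simp only [g, Sum.elim_inr]
      have := hDm false
      fun_prop
  · rintro (j | j)
    · simpa only [g, Sum.elim_inl, hEξ] using! hEZ j
    · simpa only [g, Sum.elim_inr, hVξ] using! hv0Z j
  · rintro (j | j)
    · have h1 := RegImp.momVec_add (μ := μ) (Z := Z 0) (w := u 0)
        (w' := fun ω => β * (RegImp.ind true (m 0 ω) * v 0 ω))
        (fun j => (huZ j).integrable one_le_two) fun j => by
          simpa only [mul_assoc] using ((hv1Z j).integrable one_le_two).const_mul β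
      have h2 := congrFun (hVmean true) j
      have h3 := congrFun h1 j
      rw [hZu, zero_add] at h3
      simp only [g, Sum.elim_inl, hEξ]
      refine h3.trans ?_
      simp only [RegImp.momVec, mul_assoc] at h2 ⊢
      rw [integral_const_mul, h2, Pi.zero_apply, mul_zero]
    · simpa only [g, Sum.elim_inr, hVξ] using! congrFun (hVmean false) j
  · rintro n (j | j)
    · exact hRm n j
    · exact hSm n j
  · filter_upwards [hlim] with ω hω
    rintro (j | j)
    · exact tendsto_pi_nhds.1 hω.2.2.1 j
    · exact tendsto_pi_nhds.1 hω.2.2.2 j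
  · intro n
    -- At `n = 0` the factor `√n` annihilates the statistic.
    rcases eq_or_ne n 0 with rfl | hn
    · simp
    · simp only [hbeta n _ hn]
      exact ((RegImp.measurable_dotProduct (hRm n)
        (RegImp.measurable_empVec hξm hζm hYm n)).sub_const β).const_mul _
  · filter_upwards [hlim] with ω hω
    filter_upwards [hω.1, hω.2.1, eventually_ne_atTop 0] with n hn0 hnD hn
    have hc : c n ω = G₀ n ω *ᵥ π + RegImp.empVec ξ ζ (fun t => D false t * V t) n ω := by
      rw [← RegImp.empVec_mul_dotProduct, ← RegImp.empVec_add]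
      refine congrArg (fun w => RegImp.empVec ξ ζ w n ω) ?_
      funext t
      simp only [V]
      ring
    have hz : RegImp.empVec ξ ζ Y n ω =
        β • (c n ω + G₁ n ω *ᵥ π) + RegImp.empVec ξ ζ E n ω := by
      rw [← RegImp.empVec_mul_dotProduct, ← RegImp.empVec_add, ← RegImp.empVec_const_mul,
        ← RegImp.empVec_add]
      refine congrArg (fun w => RegImp.empVec ξ ζ w n ω) ?_
      funext t
      have := RegImp.ind_false_add_ind_true (M t)
      simp only [E, V, D]
      -- The term `β x` is split between observed and missing rows by the two indicators, which sum
      -- to `1`.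
      linear_combination (-β * X t) * this
    rw [hbeta n ω hn, RegImp.tslsRow_impCross_sub hn0 hc hz hnD]
    simp only [g, Fintype.sum_sum_type, Sum.elim_inl, Sum.elim_inr, mul_add, dotProduct,
      Finset.mul_sum]
    congr 1 <;> refine Finset.sum_congr rfl fun j _ => ?_ <;> exact mul_left_comm _ _ _
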